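/- A *profinite dimensional manifold* is a second countable Hausdorff space $M=\varprojlim_{i\in\mathbb N}M_i$, where $(M_i,\mu_{ij})_{i\le j}$ is a projective system of smooth finite dimensional (Hausdorff) manifolds and surjective submersions $\mu_{ij}:M_j\to M_i$, and $M$ carries the initial topology of the canonical maps $\mu_i:M\to M_i$. A function on an open $U\subset M$ is smooth if it equals $g_i\circ\mu_i|_U$ for some $i$ and some smooth $g_i:\mu_i(U)\to\mathbb R$; a continuous map is smooth if it pulls back smooth functions on open sets to smooth functions. A map $f:N\to M$ is called a *smooth embedding* (resp. *diffeomorphism*) if, after passing to projective subsystems of the given systems $(N_i)$ and $(M_i)$, there are smooth embeddings (resp. diffeomorphisms) $f_i:N_i\to M_i$ with $f_i\circ\nu_i=\mu_i\circ f$ for all $i$. (Finite dimensional manifolds are the case of constant systems, where these are the usual notions.) Let $\mathfrak T$ be a subcategory of the category of profinite dimensional manifolds and smooth maps (more generally, a category with a faithful functor to it). An object with finite symmetries $(M,G)$ is an object $M$ of $\mathfrak T$ with an action of a finite group $G$ by automorphisms of $M$ in $\mathfrak T$ which are diffeomorphisms in the above sense. A morphism $(\varphi,\iota):(N,H)\to(M,G)$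 is a $\mathfrak T$-morphism $\varphi:N\to M$ together with a group homomorphism $\iota:H\to G$ such that $\varphi(hy)=\iota(h)\varphi(y)$ for all $h\in H$, $y\in N$; it induces $\overline\varphi:N/H\to M/G$. It is an *open embedding* if $\varphi$ is a smooth embedding and an open map, and $\overline\varphi$ is a homeomorphism onto an open subset of $M/G$. Two morphisms $(\varphi,\iota),(\varphi',\iota'):(N,H)\to(M,G)$ are *equivalent* if for some $g\in G$ one has $\varphi'=g\varphi$ and $\iota'(h)=g\,\iota(h)\,g^{-1}$ for all $h\in H$. **Theorem.** Let $(N,H)$ and $(M,G)$ be objects with finite symmetries, with $N$ and $M$ connected, and let $G$ act effectively on $M$. (SYM3) If moreover $H$ acts effectively on $N$, then two open embeddings $(\varphi,\iota),(\varphi',\iota'):(N,H)\to(M,G)$ are equivalent if and only if $\overline\varphi=\overline{\varphi'}$. (SYM4) Let $(\varphi,\iota):(N,H)\to(M,G)$ be an open embedding and let $g\in G$. If $g\varphi(N)\cap\varphi(N)\ne\emptyset$, then $g\varphi(N)=\varphi(N)$ and $g$ lies in the image of $\iota$. No assumption is made on the codimension of the strata of $(N,H)$ and $(M,G)$. -/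

import Mathlib

open CategoryTheory Topology
open scoped Manifold ContDiff

universe u v w

/-! ### Profinite dimensional manifolds -/

/-- A profinite dimensional manifold: a second countable Hausdorff space which is the projective
limit of a sequence of smooth finite dimensional manifolds with surjective submersions as
transition maps. -/
structure PFMan : Type (u + 1) where
  /-- the underlying space -/
  carrier : Type u
  [top : TopologicalSpace carrier]
  [t2 : T2Space carrier]
  [secondCountable : SecondCountableTopology carrier]
  /-- the dimension of the `i`-th manifold of the projective system -/
  dim : ℕ → ℕ
  /-- the `i`-th manifold of the projective system -/
  level : ℕ → Type u
  [levelTop : ∀ i, TopologicalSpace (level i)]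
  [levelT2 : ∀ i, T2Space (level i)]
  [levelCharted : ∀ i, ChartedSpace (EuclideanSpace ℝ (Fin (dim i))) (level i)]
  [levelManifold : ∀ i, IsManifold (𝓡 (dim i)) ∞ (level i)]
  /-- the transition map from level `j` to level `i ≤ j` -/
  trans : ∀ {i j : ℕ}, i ≤ j → level j → level i
  trans_refl : ∀ (i : ℕ) (x : level i), trans (le_refl i) x = x
  trans_trans : ∀ {i j k : ℕ} (hij : i ≤ j) (hjk : j ≤ k) (x : level k),
    trans hij (trans hjk x) = trans (hij.trans hjk) x
  trans_surjective : ∀ {i j : ℕ} (h : i ≤ j), Function.Surjective (trans h)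
  trans_submersion : ∀ {i j : ℕ} (h : i ≤ j),
    Manifold.IsSubmersion (𝓡 (dim j)) (𝓡 (dim i)) ∞ (trans h)
  /-- the canonical map from the limit to level `i` -/
  proj : ∀ i : ℕ, carrier → level i
  trans_proj : ∀ {i j : ℕ} (h : i ≤ j) (x : carrier), trans h (proj j x) = proj i x
  /-- the topology is the initial one with respect to the canonical maps -/
  isInducing : IsInducing (fun (x : carrier) (i : ℕ) => proj i x)
  /-- every compatible thread comes from exactly one point -/
  existsUnique_of_thread : ∀ t : (∀ i, level i),
    (∀ (i j : ℕ) (h : i ≤ j), trans h (t j) = t i) → ∃! x : carrier, ∀ i, proj i x = t i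

namespace PFMan

attribute [instance] top t2 secondCountable levelTop levelT2 levelCharted levelManifold

/-- `g` is a smooth real function on the (open) set `U`: it is the pullback of a smooth function
on the image of `U` in one of the manifolds of the projective system. -/
def IsSmoothFunOn (M : PFMan.{u}) (U : Set M.carrier) (g : M.carrier → ℝ) : Prop :=
  ∃ (i : ℕ) (γ : M.level i → ℝ),
    ContMDiffOn (𝓡 (M.dim i)) 𝓘(ℝ, ℝ) ∞ γ (M.proj i '' U) ∧ ∀ x ∈ U, g x = γ (M.proj i x)

/-- Smooth maps: continuous maps which pull back smooth functions on open sets to smooth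
functions. -/
def IsSmooth {N M : PFMan.{u}} (f : N.carrier → M.carrier) : Prop :=
  Continuous f ∧ ∀ (U : Set M.carrier) (g : M.carrier → ℝ), IsOpen U →
    M.IsSmoothFunOn U g → N.IsSmoothFunOn (f ⁻¹' U) (g ∘ f)

/-- The category of profinite dimensional manifolds and smooth maps. -/
instance : Category PFMan.{u} where
  Hom N M := {f : N.carrier → M.carrier // IsSmooth f}
  id M := ⟨id, continuous_id, fun _ _ _ hg => hg⟩
  comp f g := ⟨g.1 ∘ f.1, g.2.1.comp f.2.1, fun U h hU hh =>
    f.2.2 (g.1 ⁻¹' U) (h ∘ g.1) (hU.preimage g.2.1) (g.2.2 U h hU hh)⟩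

/-- Smooth embeddings of profinite dimensional manifolds: after passing to projective subsystems
(along `a` and `b`), the map is the limit of smooth embeddings of the manifolds of the two
systems. -/
def IsSmoothEmbedding {N M : PFMan.{u}} (f : N.carrier → M.carrier) : Prop :=
  ∃ (a b : ℕ → ℕ) (φ : ∀ i, N.level (a i) → M.level (b i)), StrictMono a ∧ StrictMono b ∧
    (∀ i, Manifold.IsSmoothEmbedding (𝓡 (N.dim (a i))) (𝓡 (M.dim (b i))) ∞ (φ i)) ∧
    ∀ i x, φ i (N.proj (a i) x) = M.proj (b i) (f x)

/-- Diffeomorphisms of profinite dimensional manifolds: after passing to projective subsystems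
(along `a` and `b`), the map is the limit of diffeomorphisms of the manifolds of the two
systems. -/
def IsDiffeomorphism {N M : PFMan.{u}} (f : N.carrier → M.carrier) : Prop :=
  ∃ (a b : ℕ → ℕ) (φ : ∀ i, Diffeomorph (𝓡 (N.dim (a i))) (𝓡 (M.dim (b i)))
      (N.level (a i)) (M.level (b i)) ∞), StrictMono a ∧ StrictMono b ∧
    ∀ i x, φ i (N.proj (a i) x) = M.proj (b i) (f x)

end PFMan

/-! ### Objects with finite symmetries

`T` is a category of profinite dimensional manifolds (possibly with extra structure) and smooth
maps, given by a faithful functor `F : T ⥤ PFMan`; the inclusion of a subcategory is an example.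
A finite group is a compact Lie group of dimension zero, with the discrete topology, so that
group homomorphisms carry no continuity condition. -/

/-- A `T`-object with symmetry group `G`: an object on which `G` acts by automorphisms in `T`
whose underlying maps are diffeomorphisms. -/
structure SymObj {T : Type w} [Category.{v} T] (F : T ⥤ PFMan.{u}) (G : Type*) [Group G] where
  /-- the underlying object -/
  obj : T
  /-- the action -/
  act : G →* Aut obj
  isDiffeomorphism : ∀ g : G, PFMan.IsDiffeomorphism (F.map (act g).hom).1

namespace SymObj

variable {T : Type w} [Category.{v} T] {F : T ⥤ PFMan.{u}} {G : Type*} [Group G]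

/-- The underlying topological space. -/
def Pt (M : SymObj F G) : Type u := (F.obj M.obj).carrier

instance (M : SymObj F G) : TopologicalSpace M.Pt :=
  inferInstanceAs (TopologicalSpace (F.obj M.obj).carrier)

/-- The action of `G` on the underlying space. -/
instance (M : SymObj F G) : MulAction G M.Pt where
  smul g x := (F.map (M.act g).hom).1 x
  one_smul x := by
    change (F.map (M.act 1).hom).1 x = x
    rw [map_one]
    change (F.map (𝟙 M.obj)).1 x = x
    rw [F.map_id]
    rfl
  mul_smul g h x := by
    change (F.map (M.act (g * h)).hom).1 x = (F.map (M.act g).hom).1 ((F.map (M.act h).hom).1 x)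
    rw [map_mul]
    change (F.map ((M.act h).hom ≫ (M.act g).hom)).1 x = _
    rw [F.map_comp]
    rfl

/-- The map on underlying spaces of a morphism of `T`. -/
def mapPt {H : Type*} [Group H] {N : SymObj F H} {M : SymObj F G} (φ : N.obj ⟶ M.obj) :
    N.Pt → M.Pt := (F.map φ).1

/-- The orbit space, with the quotient topology. -/
abbrev OrbitSpace (M : SymObj F G) : Type u := MulAction.orbitRel.Quotient G M.Pt

end SymObj

/-- A morphism `(φ, ι) : (N, H) → (M, G)`: a morphism `φ` of `T` and a group homomorphism `ι`
such that `φ (h y) = ι(h) φ (y)`. -/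
structure SymHom {T : Type w} [Category.{v} T] {F : T ⥤ PFMan.{u}} {H G : Type*} [Group H]
    [Group G] (N : SymObj F H) (M : SymObj F G) where
  /-- the morphism `φ` of `T` -/
  mor : N.obj ⟶ M.obj
  /-- the homomorphism `ι` -/
  ι : H →* G
  equivariant : ∀ (h : H) (y : N.Pt),
    SymObj.mapPt (M := M) mor (h • y) = ι h • SymObj.mapPt (M := M) mor y

namespace SymHom

variable {T : Type w} [Category.{v} T] {F : T ⥤ PFMan.{u}} {H G : Type*} [Group H] [Group G]
  {N : SymObj F H} {M : SymObj F G}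

/-- The map on underlying spaces. -/
def toFun (Φ : SymHom N M) : N.Pt → M.Pt := SymObj.mapPt Φ.mor

/-- The induced map on orbit spaces. -/
def orbitMap (Φ : SymHom N M) : N.OrbitSpace → M.OrbitSpace :=
  Quotient.map' Φ.toFun (by
    rintro _ y ⟨h, rfl⟩
    exact ⟨Φ.ι h, (Φ.equivariant h y).symm⟩)

/-- `(φ, ι)` is an embedding: `φ` is a smooth embedding and the induced map on orbit spaces is a
homeomorphism onto an open subset. -/
def IsEmbedding (Φ : SymHom N M) : Prop :=
  PFMan.IsSmoothEmbedding (F.map Φ.mor).1 ∧ Topology.IsOpenEmbedding Φ.orbitMap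

/-- `(φ, ι)` is an open embedding: an embedding with `φ` an open map. -/
def IsOpenEmbedding (Φ : SymHom N M) : Prop :=
  Φ.IsEmbedding ∧ IsOpenMap Φ.toFun

/-- `(φ', ι') = (g, Ad_g) (φ, ι)` for some `g` in `G`. -/
def Equivalent (Φ Φ' : SymHom N M) : Prop :=
  ∃ g : G, Φ'.mor = Φ.mor ≫ (M.act g).hom ∧ ∀ h : H, Φ'.ι h = g * Φ.ι h * g⁻¹

end SymHom

/-!
A diffeomorphism `f` of finite order of a connected manifold is the identity as soon as it fixes a
point `x` with identity derivative: the average of a chart over the iterates of `f` is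
`f`-invariant, and its derivative at `x` is invertible, so it is injective near `x` and `f` is the
identity there; the set of such points `x` is open and closed.

If `φ̄ = φ̄'`, the closed sets `{y | φ' y = g • φ y}` form a finite cover of `N`, so the closures of
their interiors still cover `N`. At a point common to two of these closures, for `g` and `k`, both
the values and, by continuity, the derivatives of `g • φ` and `k • φ` agree with those of `φ'`. As
`φ` is open and an embedding, its derivative is surjective on the levels, so `g⁻¹ k` fixes a point
with identity derivative on each level it acts on, and `g = k`. Connectedness of `N` then leaves a
single `g`.

If `g φ(N)` meets `φ(N)`, then `{y | g • φ y ∈ φ(N)}` is open and nonempty, and injectivity of `φ̄`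
makes it the finite union of the closed sets `{y | g • φ y = γ • φ y}` for `γ` in the image of `ι`.
By connectedness it is all of `N`, so one of these sets has interior, where `g` and `γ` agree.
-/

section FiniteClosedCovers

variable {X ι : Type*} [TopologicalSpace X] [Finite ι] {C : ι → Set X}

theorem dense_iUnion_interior_of_finite_closed (hC : ∀ i, IsClosed (C i))
    (hcover : ⋃ i, C i = Set.univ) : Dense (⋃ i, interior (C i)) := by
  have hdense : Dense (⋂₀ Set.range fun i => (frontier (C i))ᶜ) := by
    refine (Set.finite_range _).dense_sInter ?_ ?_ <;> rintro _ ⟨i, rfl⟩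
    · exact isClosed_frontier.isOpen_compl
    · exact interior_eq_empty_iff_dense_compl.1 (interior_frontier (hC i))
  refine hdense.mono fun x hx => ?_
  obtain ⟨i, hi⟩ := Set.iUnion_eq_univ_iff.1 hcover x
  have hxi : x ∉ frontier (C i) := hx _ ⟨i, rfl⟩
  rw [(hC i).frontier_eq] at hxi
  exact Set.mem_iUnion.2 ⟨i, not_not.1 fun h => hxi ⟨hi, h⟩⟩

theorem exists_eq_univ_of_disjoint_closure_interior [ConnectedSpace X] (hC : ∀ i, IsClosed (C i))
    (hcover : ⋃ i, C i = Set.univ)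
    (hdisj : Pairwise (Function.onFun Disjoint fun i => closure (interior (C i)))) :
    ∃ i, C i = Set.univ := by
  have hcover' : ⋃ i, closure (interior (C i)) = Set.univ := by
    rw [← closure_iUnion_of_finite]
    exact (dense_iUnion_interior_of_finite_closed hC hcover).closure_eq
  have : Subsingleton {i // (closure (interior (C i))).Nonempty} := by
    refine subsingleton_of_disjoint_isClosed_iUnion_eq_univ (s := fun i => closure (interior (C i)))
      (fun i => i.2) (fun i j hij => hdisj (Subtype.coe_ne_coe.2 hij))
      (fun _ => isClosed_closure) ?_
    refine Set.iUnion_eq_univ_iff.2 fun y => ?_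
    obtain ⟨j, hj⟩ := Set.iUnion_eq_univ_iff.1 hcover' y
    exact ⟨⟨j, y, hj⟩, hj⟩
  obtain ⟨x⟩ := (inferInstance : Nonempty X)
  obtain ⟨i, hi⟩ := Set.iUnion_eq_univ_iff.1 hcover' x
  refine ⟨i, Set.eq_univ_of_forall fun y => ?_⟩
  obtain ⟨j, hj⟩ := Set.iUnion_eq_univ_iff.1 hcover' y
  obtain rfl : i = j := Subtype.mk.inj (this.elim ⟨i, x, hi⟩ ⟨j, y, hj⟩)
  exact closure_minimal interior_subset (hC i) hj

end FiniteClosedCovers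

theorem mem_closure_interior_setOf_iff {X : Type*} [TopologicalSpace X] {p : X → Prop} {x : X} :
    x ∈ closure (interior {y | p y}) ↔ ∃ᶠ y in 𝓝 x, ∀ᶠ z in 𝓝 y, p z := by
  simp only [mem_closure_iff_frequently, mem_interior_iff_mem_nhds, Filter.Eventually]

theorem eq_of_frequently_eventuallyEq {X Y : Type*} [TopologicalSpace X] [TopologicalSpace Y]
    [T2Space Y] {f g : X → Y} {x : X} (hf : ContinuousAt f x) (hg : ContinuousAt g x)
    (hfg : ∃ᶠ p in 𝓝 x, f =ᶠ[𝓝 p] g) : f x = g x :=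
  tendsto_nhds_unique_of_frequently_eq hf hg (hfg.mono fun _ => Filter.EventuallyEq.eq_of_nhds)

theorem frequently_eventuallyEq_of_comp {X Y Z : Type*} [TopologicalSpace X] [TopologicalSpace Y]
    {π : X → Y} (hπ : IsOpenMap π) (hcont : Continuous π) {f g : Y → Z} {x : X}
    (h : ∃ᶠ p in 𝓝 x, f ∘ π =ᶠ[𝓝 p] g ∘ π) : ∃ᶠ q in 𝓝 (π x), f =ᶠ[𝓝 q] g := by
  rw [← hπ.map_nhds_eq hcont.continuousAt, Filter.frequently_map]
  refine h.mono fun p hp => ?_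
  rw [← hπ.map_nhds_eq hcont.continuousAt]
  exact hp

section Derivative

variable {𝕜 : Type*} [NontriviallyNormedField 𝕜]
  {E E' : Type*} [NormedAddCommGroup E] [NormedSpace 𝕜 E] [NormedAddCommGroup E']
  [NormedSpace 𝕜 E'] {H H' : Type*} [TopologicalSpace H] [TopologicalSpace H']
  {I : ModelWithCorners 𝕜 E H} {I' : ModelWithCorners 𝕜 E' H'}
  {X Y : Type*} [TopologicalSpace X] [ChartedSpace H X] [TopologicalSpace Y] [ChartedSpace H' Y]

theorem inTangentCoordinates_id_self [IsManifold I 1 X] [IsManifold I' 1 Y] (f : X → Y)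
    (φ : X → E →L[𝕜] E') (x : X) : inTangentCoordinates I I' id f φ x x = φ x := by
  rw [inTangentCoordinates_eq id f φ (mem_chart_source _ _) (mem_chart_source _ _)]
  ext v
  change (tangentBundleCore I' Y).coordChange (achart H' (f x)) (achart H' (f x)) (f x)
    (φ x ((tangentBundleCore I X).coordChange (achart H x) (achart H x) x v)) = φ x v
  rw [(tangentBundleCore I X).coordChange_self _ _ (mem_chart_source _ _),
    (tangentBundleCore I' Y).coordChange_self _ _ (mem_chart_source _ _)]

theorem mfderiv_eq_of_frequently_eventuallyEq [IsManifold I 1 X] [IsManifold I' 1 Y] [T2Space Y]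
    {f g : X → Y} {x : X} (hf : ContMDiffAt I I' 1 f x)
    (hg : ContMDiffAt I I' 1 g x) (hfg : ∃ᶠ p in 𝓝 x, f =ᶠ[𝓝 p] g) :
    (mfderiv I I' f x : E →L[𝕜] E') = mfderiv I I' g x := by
  have hx := eq_of_frequently_eventuallyEq hf.continuousAt hg.continuousAt hfg
  have hcont (φ : X → Y) (hφ : ContMDiffAt I I' 1 φ x) :
      ContinuousAt (inTangentCoordinates I I' id φ (mfderiv I I' φ) x) x :=
    (hφ.mfderiv_const (m := 0) (by simp)).continuousAt
  have hev : ∃ᶠ p in 𝓝 x, inTangentCoordinates I I' id f (mfderiv I I' f) x p =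
      inTangentCoordinates I I' id g (mfderiv I I' g) x p := by
    refine hfg.mono fun p hp => ?_
    have hderiv : (mfderiv I I' f p : E →L[𝕜] E') = mfderiv I I' g p := hp.mfderiv_eq
    simp only [inTangentCoordinates, hx]
    change ContinuousLinearMap.inCoordinates E (TangentSpace I) E' (TangentSpace I') x p (g x) (f p)
      (show E →L[𝕜] E' from mfderiv I I' f p) = _
    rw [hderiv, hp.eq_of_nhds]
    rfl
  have := tendsto_nhds_unique_of_frequently_eq (hcont f hf) (hcont g hg) hev
  exact (inTangentCoordinates_id_self f _ x).symm.trans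
    (this.trans (inTangentCoordinates_id_self g _ x))

end Derivative

section FiniteOrder

theorem hasMFDerivAt_iterate_of_hasMFDerivAt_id {𝕜 : Type*} [NontriviallyNormedField 𝕜]
    {E : Type*} [NormedAddCommGroup E] [NormedSpace 𝕜 E] {H : Type*} [TopologicalSpace H]
    {I : ModelWithCorners 𝕜 E H} {X : Type*} [TopologicalSpace X] [ChartedSpace H X] {f : X → X}
    {x : X} (hx : f x = x) (hf : HasMFDerivAt I I f x (.id 𝕜 E)) (k : ℕ) :
    HasMFDerivAt I I f^[k] x (.id 𝕜 E) := by
  induction k with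
  | zero => exact hasMFDerivAt_id x
  | succ k ih =>
    rw [← hx] at ih
    exact ih.comp x hf

variable {𝕜 : Type*} [RCLike 𝕜] {E : Type*} [NormedAddCommGroup E] [NormedSpace 𝕜 E]
  {H : Type*} [TopologicalSpace H] {I : ModelWithCorners 𝕜 E H} [I.Boundaryless]
  {X : Type*} [TopologicalSpace X] [ChartedSpace H X]

theorem hasStrictFDerivAt_writtenInExtChartAt {E' : Type*} [NormedAddCommGroup E']
    [NormedSpace 𝕜 E'] {H' : Type*} [TopologicalSpace H'] {I' : ModelWithCorners 𝕜 E' H'}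
    {Y : Type*} [TopologicalSpace Y] [ChartedSpace H' Y] {f : X → Y} {x : X} {f' : E →L[𝕜] E'}
    (hf : ContMDiffAt I I' 1 f x) (hf' : HasMFDerivAt I I' f x f') :
    HasStrictFDerivAt (writtenInExtChartAt I I' x f) f' (extChartAt I x x) := by
  have hcont := (contMDiffAt_iff.1 hf).2
  have hderiv := hf'.2
  rw [I.range_eq_univ] at hcont hderiv
  exact (hcont.contDiffAt Filter.univ_mem).hasStrictFDerivAt' hderiv.hasFDerivAt_of_univ
    one_ne_zero

variable {f : X → X} {n : ℕ}

theorem hasStrictFDerivAt_birkhoffAverage_extChartAt (hf : ContMDiff I I 1 f) (hn : n ≠ 0) {x : X}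
    (hx : f x = x) (hfx : HasMFDerivAt I I f x (.id 𝕜 E)) :
    HasStrictFDerivAt (birkhoffAverage 𝕜 f (extChartAt I x) n ∘ (extChartAt I x).symm)
      (.id 𝕜 E) (extChartAt I x x) := by
  have hterm (k : ℕ) : HasStrictFDerivAt (extChartAt I x ∘ f^[k] ∘ (extChartAt I x).symm)
      (.id 𝕜 E) (extChartAt I x x) := by
    have := hasStrictFDerivAt_writtenInExtChartAt (hf.iterate k x)
      (hasMFDerivAt_iterate_of_hasMFDerivAt_id hx hfx k)
    rwa [writtenInExtChartAt, Function.iterate_fixed hx] at this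
  have hsum := (HasStrictFDerivAt.fun_sum fun k (_ : k ∈ Finset.range n) => hterm k).const_smul
    (n : 𝕜)⁻¹
  have hn' : (n : 𝕜) ≠ 0 := Nat.cast_ne_zero.2 hn
  rw [Finset.sum_const, Finset.card_range, ← Nat.cast_smul_eq_nsmul 𝕜, smul_smul,
    inv_mul_cancel₀ hn', one_smul] at hsum
  exact hsum

theorem eventually_eq_self_of_mfderiv_eq_id (hf : ContMDiff I I 1 f) (hn : n ≠ 0)
    (hfn : f^[n] = id) {x : X} (hx : f x = x)
    (hfx : (mfderiv I I f x : E →L[𝕜] E) = .id 𝕜 E) :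
    ∀ᶠ p in 𝓝 x, f p = p := by
  set e := extChartAt I x
  set A := birkhoffAverage 𝕜 f e n
  have hinv (p : X) : A (f p) = A p := by
    rw [← sub_eq_zero, birkhoffAverage_apply_sub_birkhoffAverage, hfn, id, sub_self, smul_zero]
  obtain ⟨s, hs, hinj⟩ : ∃ s ∈ 𝓝 (e x), Set.InjOn (A ∘ e.symm) s := by
    have hA : HasStrictFDerivAt (A ∘ e.symm) (ContinuousLinearEquiv.refl 𝕜 E : E →L[𝕜] E) (e x) :=
      hasStrictFDerivAt_birkhoffAverage_extChartAt hf hn hx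
        (hfx ▸ (hf.mdifferentiable one_ne_zero x).hasMFDerivAt)
    obtain ⟨s, hxs, hs, happrox⟩ := hA.approximates_deriv_on_open_nhds
    exact ⟨s, hs.mem_nhds hxs, happrox.injOn <|
      (ContinuousLinearEquiv.refl 𝕜 E).subsingleton_or_nnnorm_symm_pos.imp_right fun hpos =>
        NNReal.half_lt_self (inv_pos.2 hpos).ne'⟩
  have hcont : Filter.Tendsto f (𝓝 x) (𝓝 x) := by
    simpa only [ContinuousAt, hx] using hf.continuous.continuousAt (x := x)
  have hmem : ∀ᶠ p in 𝓝 x, p ∈ e.source ∧ e p ∈ s :=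
    Filter.inter_mem (extChartAt_source_mem_nhds x) (continuousAt_extChartAt x hs)
  filter_upwards [hmem, hcont.eventually hmem] with p hp hfp
  refine e.injOn hfp.1 hp.1 (hinj hfp.2 hp.2 ?_)
  simp only [Function.comp_apply, e.left_inv hp.1, e.left_inv hfp.1, hinv]

variable [IsManifold I 1 X]

theorem eq_id_of_frequently_eventuallyEq_id [T2Space X] [ConnectedSpace X]
    (hf : ContMDiff I I 1 f) (hn : n ≠ 0) (hfn : f^[n] = id) {x : X}
    (hx : ∃ᶠ p in 𝓝 x, f =ᶠ[𝓝 p] id) : f = id := by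
  have hclopen : IsClopen (interior {p | f p = p}) := by
    refine ⟨isClosed_of_closure_subset fun y hy => ?_, isOpen_interior⟩
    have hfreq : ∃ᶠ p in 𝓝 y, f =ᶠ[𝓝 p] id := mem_closure_interior_setOf_iff.1 hy
    have hfy : f y = y := eq_of_frequently_eventuallyEq hf.continuous.continuousAt
      continuousAt_id hfreq
    have hderiv : (mfderiv I I f y : E →L[𝕜] E) = .id 𝕜 E :=
      (mfderiv_eq_of_frequently_eventuallyEq hf.contMDiffAt contMDiffAt_id hfreq).trans mfderiv_id
    exact mem_interior_iff_mem_nhds.2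
      (eventually_eq_self_of_mfderiv_eq_id hf hn hfn hfy hderiv)
  obtain ⟨p, hp⟩ := hx.exists
  funext y
  have := hclopen.eq_univ ⟨p, mem_interior_iff_mem_nhds.2 hp⟩
  exact interior_subset (s := {p | f p = p}) (this ▸ Set.mem_univ y)

theorem eq_id_of_frequently_eq_of_frequently_eq_comp [T2Space X] [ConnectedSpace X] {E' : Type*}
    [NormedAddCommGroup E'] [NormedSpace 𝕜 E'] {H' : Type*} [TopologicalSpace H']
    {I' : ModelWithCorners 𝕜 E' H'} {Z : Type*} [TopologicalSpace Z] [ChartedSpace H' Z]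
    [IsManifold I' 1 Z] (hf : ContMDiff I I 1 f) (hn : n ≠ 0) (hfn : f^[n] = id)
    {φ χ : Z → X} {z : Z} (hφ : ContMDiffAt I' I 1 φ z) (hχ : ContMDiffAt I' I 1 χ z)
    (hsurj : Function.Surjective (mfderiv I' I φ z : E' →L[𝕜] E))
    (heq : ∃ᶠ p in 𝓝 z, χ =ᶠ[𝓝 p] φ) (heqcomp : ∃ᶠ p in 𝓝 z, χ =ᶠ[𝓝 p] f ∘ φ) : f = id := by
  have hfφ : ContMDiffAt I' I 1 (f ∘ φ) z := hf.contMDiffAt.comp z hφ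
  have hfix : f (φ z) = φ z :=
    (eq_of_frequently_eventuallyEq hχ.continuousAt hfφ.continuousAt heqcomp).symm.trans
      (eq_of_frequently_eventuallyEq hχ.continuousAt hφ.continuousAt heq)
  have hderiv : (mfderiv I' I (f ∘ φ) z : E' →L[𝕜] E) = mfderiv I' I φ z :=
    (mfderiv_eq_of_frequently_eventuallyEq hχ hfφ heqcomp).symm.trans
      (mfderiv_eq_of_frequently_eventuallyEq hχ hφ heq)
  have hid : (mfderiv I I f (φ z) : E →L[𝕜] E) = .id 𝕜 E := by
    rw [mfderiv_comp z (hf.mdifferentiable one_ne_zero _) (hφ.mdifferentiableAt one_ne_zero)]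
      at hderiv
    ext v
    obtain ⟨u, rfl⟩ := hsurj v
    exact DFunLike.congr_fun hderiv u
  have := eventually_eq_self_of_mfderiv_eq_id hf hn hfn hfix hid
  exact eq_id_of_frequently_eventuallyEq_id hf hn hfn this.eventually_nhds.frequently

end FiniteOrder

section LocalSection

variable {𝕜 : Type*} [NontriviallyNormedField 𝕜]
  {E E' : Type*} [NormedAddCommGroup E] [NormedSpace 𝕜 E] [NormedAddCommGroup E']
  [NormedSpace 𝕜 E'] {H H' : Type*} [TopologicalSpace H] [TopologicalSpace H']
  (I : ModelWithCorners 𝕜 E H) (I' : ModelWithCorners 𝕜 E' H') (n : ℕ∞ω)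
  {X Y : Type*} [TopologicalSpace X] [ChartedSpace H X] [TopologicalSpace Y] [ChartedSpace H' Y]

/-- `f` has a `C^n` right inverse near `f x` which maps `f x` to `x`. -/
def HasLocalSectionAt (f : X → Y) (x : X) : Prop :=
  ∃ s : Y → X, s (f x) = x ∧ ContMDiffAt I' I n s (f x) ∧ f ∘ s =ᶠ[𝓝 (f x)] id

variable {I I' n} {f : X → Y} {x : X}

theorem HasLocalSectionAt.nhds_le_map (hf : HasLocalSectionAt I I' n f x) :
    𝓝 (f x) ≤ Filter.map f (𝓝 x) := by
  obtain ⟨s, hsx, hs, hfs⟩ := hf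
  calc 𝓝 (f x) = Filter.map f (Filter.map s (𝓝 (f x))) := by
        rw [Filter.map_map, Filter.map_congr hfs, Filter.map_id]
    _ ≤ Filter.map f (𝓝 x) := Filter.map_mono (by
        have : Filter.Tendsto s (𝓝 (f x)) (𝓝 (s (f x))) := hs.continuousAt
        rwa [hsx] at this)

theorem HasLocalSectionAt.mfderiv_surjective (hf : HasLocalSectionAt I I' n f x) (hn : n ≠ 0)
    (hfx : MDifferentiableAt I I' f x) :
    Function.Surjective (mfderiv I I' f x : E →L[𝕜] E') := by
  obtain ⟨s, hsx, hs, hfs⟩ := hf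
  have hcomp : mfderiv I' I' (f ∘ s) (f x) = _ :=
    mfderiv_comp (f x) (hsx.symm ▸ hfx) (hs.mdifferentiableAt hn)
  rw [hfs.mfderiv_eq, hsx] at hcomp
  intro v
  refine ⟨(mfderiv I' I s (f x) : E' →L[𝕜] E) v, ?_⟩
  have hid : (mfderiv I' I' id (f x) : E' →L[𝕜] E') v = v := DFunLike.congr_fun mfderiv_id v
  exact (DFunLike.congr_fun hcomp v).symm.trans hid

theorem hasLocalSectionAt_of_eqOn_extend [I.Boundaryless]
    {d : OpenPartialHomeomorph X H} {c : OpenPartialHomeomorph Y H'}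
    (hd : d ∈ IsManifold.maximalAtlas I n X) (hc : c ∈ IsManifold.maximalAtlas I' n Y)
    (hx : x ∈ d.source) (hmaps : d.source ⊆ f ⁻¹' c.source) {L : E →L[𝕜] E'} {R : E' →L[𝕜] E}
    (hLR : Function.LeftInverse L R)
    (hf : Set.EqOn (c.extend I' ∘ f ∘ (d.extend I).symm) L (d.extend I).target) :
    HasLocalSectionAt I I' n f x := by
  set δ := d.extend I with hδ
  set γ := c.extend I' with hγ
  have hxδ : x ∈ δ.source := by rwa [hδ, d.extend_source]
  have hδx : δ.target ∈ 𝓝 (δ x) := d.isOpen_extend_target.mem_nhds (δ.map_source hxδ)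
  let r : E' → E := fun v => δ x + R (v - γ (f x))
  have hr : r (γ (f x)) = δ x := by simp [r]
  have hL : L (δ x) = γ (f x) := by
    simpa only [Function.comp_apply, δ.left_inv hxδ] using (hf (δ.map_source hxδ)).symm
  have hrγ : ContMDiffAt I' 𝓘(𝕜, E) n (r ∘ γ) (f x) := by
    have : ContDiff 𝕜 n r := by fun_prop
    exact this.contMDiff.contMDiffAt.comp _ (c.contMDiffAt_extend hc (hmaps hx))
  have hδsymm : ContMDiffAt 𝓘(𝕜, E) I n δ.symm (δ x) :=
    (d.extend_target' (I := I) ▸ contMDiffOn_extend_symm hd).contMDiffAt hδx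
  refine ⟨δ.symm ∘ r ∘ γ, by simp [hr, δ.left_inv hxδ], ?_, ?_⟩
  · exact ContMDiffAt.comp _ (by rwa [Function.comp_apply, hr]) hrγ
  · have hmem : ∀ᶠ y in 𝓝 (f x), r (γ y) ∈ δ.target :=
      hrγ.continuousAt.eventually_mem (by rwa [Function.comp_apply, hr])
    filter_upwards [hmem, c.extend_source_mem_nhds (I := I') (hmaps hx)] with y hy hyγ
    have hsource : δ.symm (r (γ y)) ∈ d.source := d.extend_source (I := I) ▸ δ.map_target hy
    refine γ.injOn (by rw [hγ, c.extend_source]; exact hmaps hsource) hyγ ?_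
    calc γ (f (δ.symm (r (γ y)))) = L (r (γ y)) := hf hy
      _ = γ y := by simp [r, hL, hLR _]

theorem hasLocalSectionAt_of_isSubmersionAt [I.Boundaryless]
    (hf : Manifold.IsSubmersionAt I I' n f x) : HasLocalSectionAt I I' n f x :=
  hasLocalSectionAt_of_eqOn_extend hf.domChart_mem_maximalAtlas hf.codChart_mem_maximalAtlas
    hf.mem_domChart_source hf.source_subset_preimage_source
    (L := .fst 𝕜 E' hf.complement ∘L (hf.equiv : E →L[𝕜] E' × hf.complement))
    (R := (hf.equiv.symm : E' × hf.complement →L[𝕜] E) ∘L .inl 𝕜 E' hf.complement)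
    (fun v => by simp) hf.writtenInCharts

theorem hasLocalSectionAt_of_isImmersionAt [I.Boundaryless] [I'.Boundaryless]
    (hf : Manifold.IsImmersionAt I I' n f x)
    (hopen : 𝓝 (f x) ≤ Filter.map f (𝓝 x)) : HasLocalSectionAt I I' n f x := by
  set δ := hf.domChart.extend I
  set γ := hf.codChart.extend I'
  let L : E →L[𝕜] E' := (hf.equiv : E × hf.complement →L[𝕜] E') ∘L .inl 𝕜 E hf.complement
  have hL : Set.EqOn (γ ∘ f ∘ δ.symm) L δ.target := hf.writtenInCharts
  have hrange : ∀ᶠ v in 𝓝 (γ (f x)), v ∈ L.range := by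
    rw [← hf.codChart.map_extend_nhds_of_boundaryless hf.mem_codChart_source, Filter.eventually_map]
    refine hopen (Filter.mem_map.2 ?_)
    filter_upwards [hf.domChart.extend_source_mem_nhds (I := I) hf.mem_domChart_source] with p hp
    refine ⟨δ p, ?_⟩
    exact (hL (δ.map_source hp)).symm.trans (congrArg (γ ∘ f) (δ.left_inv hp))
  have htop : L.range = ⊤ :=
    Submodule.eq_top_of_nonempty_interior' _ ⟨γ (f x), mem_interior_iff_mem_nhds.2 hrange⟩
  refine hasLocalSectionAt_of_eqOn_extend hf.domChart_mem_maximalAtlas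
    hf.codChart_mem_maximalAtlas hf.mem_domChart_source hf.source_subset_preimage_source
    (R := .fst 𝕜 E hf.complement ∘L (hf.equiv.symm : E' →L[𝕜] E × hf.complement)) (fun v => ?_) hL
  obtain ⟨u, rfl⟩ := LinearMap.range_eq_top.1 htop v
  simp [L]

end LocalSection

namespace PFMan

variable {M N : PFMan.{u}} {i j : ℕ}

theorem contMDiff_trans (M : PFMan.{u}) (h : i ≤ j) :
    ContMDiff (𝓡 (M.dim j)) (𝓡 (M.dim i)) ∞ (M.trans h) :=
  (M.trans_submersion h).contMDiff

theorem hasLocalSectionAt_trans (h : i ≤ j) (p : M.level j) :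
    HasLocalSectionAt (𝓡 (M.dim j)) (𝓡 (M.dim i)) ∞ (M.trans h) p :=
  hasLocalSectionAt_of_isSubmersionAt ((M.trans_submersion h).isSubmersionAt p)

theorem mfderiv_trans_surjective (h : i ≤ j) (p : M.level j) :
    Function.Surjective (mfderiv (𝓡 (M.dim j)) (𝓡 (M.dim i)) (M.trans h) p :
      EuclideanSpace ℝ (Fin (M.dim j)) →L[ℝ] EuclideanSpace ℝ (Fin (M.dim i))) :=
  (hasLocalSectionAt_trans h p).mfderiv_surjective (by simp)
    ((M.contMDiff_trans h).mdifferentiable (by simp) p)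

theorem continuous_proj (M : PFMan.{u}) (i : ℕ) : Continuous (M.proj i) :=
  (continuous_apply i).comp M.isInducing.continuous

theorem ext_proj {x y : M.carrier} (h : ∀ i, ∃ j ≥ i, M.proj j x = M.proj j y) : x = y := by
  refine (M.existsUnique_of_thread (M.proj · y) fun i j hij => M.trans_proj hij y).unique
    (fun i => ?_) fun _ => rfl
  obtain ⟨j, hij, hxy⟩ := h i
  rw [← M.trans_proj hij, hxy, M.trans_proj hij]

theorem proj_surjective (M : PFMan.{u}) (i : ℕ) : Function.Surjective (M.proj i) := by
  intro p
  choose lift hlift using fun k => M.trans_surjective (Nat.le_succ (i + k))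
  let s : ∀ k, M.level (i + k) := fun k => Nat.rec p (fun k q => lift k q) k
  have hs (j k : ℕ) (h : i + j ≤ i + k) : M.trans h (s k) = s j := by
    induction k, Nat.le_of_add_le_add_left h using Nat.le_induction with
    | base => exact M.trans_refl _ _
    | succ k hjk ih =>
      rw [← M.trans_trans (Nat.add_le_add_left hjk i) (Nat.le_succ (i + k))]
      exact (congrArg _ (hlift k (s k))).trans (ih _)
  obtain ⟨x, hx, -⟩ := M.existsUnique_of_thread
    (fun j => M.trans (Nat.le_add_left j i) (s j)) fun j k hjk => by
      rw [M.trans_trans, ← hs j k (Nat.add_le_add_left hjk i), M.trans_trans]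
  exact ⟨x, (hx i).trans (hs 0 i (Nat.le_add_right i i))⟩

theorem antitone_comap_proj_nhds (x : M.carrier) :
    Antitone fun i => Filter.comap (M.proj i) (𝓝 (M.proj i x)) := by
  intro i j hij
  have hproj : M.proj i = M.trans hij ∘ M.proj j := funext fun y => (M.trans_proj hij y).symm
  have htrans := (M.contMDiff_trans hij).continuous.tendsto (M.proj j x)
  beta_reduce
  rw [← M.trans_proj hij x, hproj, ← Filter.comap_comap]
  exact Filter.comap_mono htrans.le_comap

theorem exists_ge_mem_comap_proj_nhds {x : M.carrier} {s : Set M.carrier} (hs : s ∈ 𝓝 x) (i : ℕ) :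
    ∃ j ≥ i, s ∈ Filter.comap (M.proj j) (𝓝 (M.proj j x)) := by
  have hnhds : 𝓝 x = ⨅ j, Filter.comap (M.proj j) (𝓝 (M.proj j x)) := by
    simp only [M.isInducing.nhds_eq_comap, nhds_pi, Filter.pi, Filter.comap_iInf,
      Filter.comap_comap, Function.comp_def]
  rw [hnhds, Filter.mem_iInf_of_directed (antitone_comap_proj_nhds x).directed_ge] at hs
  obtain ⟨j, hj⟩ := hs
  exact ⟨max i j, le_max_left i j, antitone_comap_proj_nhds x (le_max_right i j) hj⟩

theorem isOpenMap_proj (M : PFMan.{u}) (i : ℕ) : IsOpenMap (M.proj i) := by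
  refine isOpenMap_iff_nhds_le.2 fun x s hs => ?_
  obtain ⟨j, hij, t, ht, hts⟩ := exists_ge_mem_comap_proj_nhds (Filter.mem_map.1 hs) i
  have hts' : t ⊆ M.trans hij ⁻¹' s := by
    intro p hp
    obtain ⟨y, rfl⟩ := M.proj_surjective j p
    have hy : M.proj i y ∈ s := hts hp
    rwa [Set.mem_preimage, M.trans_proj]
  have hmap := (hasLocalSectionAt_trans hij (M.proj j x)).nhds_le_map
  rw [M.trans_proj] at hmap
  exact hmap (Filter.mem_map.2 (Filter.mem_of_superset ht hts'))

theorem connectedSpace_level [ConnectedSpace M.carrier] (i : ℕ) : ConnectedSpace (M.level i) :=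
  (M.proj_surjective i).connectedSpace (M.continuous_proj i)

/-- The map `φ` between levels represents `f` near `y`: it is smooth at the image of `y`, and it
agrees with `f` through the canonical maps at the points of a neighbourhood of `y`. -/
def RepresentsAt {a d : ℕ} (φ : N.level a → M.level d) (f : N.carrier → M.carrier)
    (y : N.carrier) : Prop :=
  ContMDiffAt (𝓡 (N.dim a)) (𝓡 (M.dim d)) ∞ φ (N.proj a y) ∧
    φ ∘ N.proj a =ᶠ[𝓝 y] M.proj d ∘ f

theorem RepresentsAt.comp_trans {a b d : ℕ} {φ : N.level a → M.level d}
    {f : N.carrier → M.carrier} {y : N.carrier} (hφ : RepresentsAt φ f y) (h : a ≤ b) :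
    RepresentsAt (φ ∘ N.trans h) f y := by
  refine ⟨ContMDiffAt.comp _ ?_ (N.contMDiff_trans h).contMDiffAt, ?_⟩
  · rw [N.trans_proj]
    exact hφ.1
  · refine hφ.2.mono fun x hx => ?_
    simpa only [Function.comp_apply, N.trans_proj] using hx

theorem RepresentsAt.comp_semiconj {a d : ℕ} {φ : N.level a → M.level d}
    {f : N.carrier → M.carrier} {y : N.carrier} (hφ : RepresentsAt φ f y)
    {σ : M.carrier → M.carrier} {ψ : M.level d → M.level d}
    (hψ : ContMDiff (𝓡 (M.dim d)) (𝓡 (M.dim d)) ∞ ψ) (hψσ : Function.Semiconj (M.proj d) σ ψ) :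
    RepresentsAt (ψ ∘ φ) (σ ∘ f) y :=
  ⟨hψ.contMDiffAt.comp _ hφ.1, hφ.2.mono fun x hx => (congrArg ψ hx).trans (hψσ (f x)).symm⟩

theorem RepresentsAt.frequently_eventuallyEq {a d : ℕ} {φ ψ : N.level a → M.level d}
    {f g : N.carrier → M.carrier} {y : N.carrier} (hφ : RepresentsAt φ f y)
    (hψ : RepresentsAt ψ g y) (hfg : ∃ᶠ z in 𝓝 y, f =ᶠ[𝓝 z] g) :
    ∃ᶠ p in 𝓝 (N.proj a y), φ =ᶠ[𝓝 p] ψ := by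
  refine frequently_eventuallyEq_of_comp (N.isOpenMap_proj a) (N.continuous_proj a) ?_
  refine (hfg.and_eventually (hφ.2.eventually_nhds.and hψ.2.eventually_nhds)).mono ?_
  rintro z ⟨hz, hφz, hψz⟩
  filter_upwards [hz, hφz, hψz] with w hw hφw hψw
  rw [hφw, hψw, Function.comp_apply, Function.comp_apply, hw]

theorem isSmoothFunOn_chartAt_apply {d : ℕ} (p : M.level d) (k : Fin (M.dim d)) :
    M.IsSmoothFunOn (M.proj d ⁻¹' (chartAt (EuclideanSpace ℝ (Fin (M.dim d))) p).source)
      fun x => chartAt (EuclideanSpace ℝ (Fin (M.dim d))) p (M.proj d x) k := by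
  refine ⟨d, fun q => chartAt (EuclideanSpace ℝ (Fin (M.dim d))) p q k, ?_, fun _ _ => rfl⟩
  have hchart : ContMDiffOn (𝓡 (M.dim d)) (𝓡 (M.dim d)) ∞ (chartAt _ p) (chartAt _ p).source :=
    contMDiffOn_chart
  have hcoord : ContDiff ℝ ∞ fun v : EuclideanSpace ℝ (Fin (M.dim d)) => v k :=
    contDiff_euclidean.1 contDiff_id k
  exact (hcoord.contMDiff.comp_contMDiffOn hchart).mono (Set.image_preimage_subset _ _)

theorem IsSmooth.exists_representsAt {f : N.carrier → M.carrier} (hf : IsSmooth f)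
    (y : N.carrier) (d : ℕ) : ∃ (a : ℕ) (φ : N.level a → M.level d), RepresentsAt φ f y := by
  set e := chartAt (EuclideanSpace ℝ (Fin (M.dim d))) (M.proj d (f y))
  set U := M.proj d ⁻¹' e.source
  have hU : IsOpen U := e.open_source.preimage (M.continuous_proj d)
  have hV : IsOpen (f ⁻¹' U) := hU.preimage hf.1
  have hy : y ∈ f ⁻¹' U := mem_chart_source _ _
  choose b γ hγ hγf using fun k => hf.2 U _ hU (isSmoothFunOn_chartAt_apply (M.proj d (f y)) k)
  obtain ⟨a, ha⟩ := (Set.finite_range b).bddAbove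
  have hba (k) : b k ≤ a := ha ⟨k, rfl⟩
  let g (p : N.level a) : EuclideanSpace ℝ (Fin (M.dim d)) :=
    WithLp.toLp 2 fun k => γ k (N.trans (hba k) p)
  have hgf : ∀ x ∈ f ⁻¹' U, g (N.proj a x) = e (M.proj d (f x)) := by
    intro x hx
    ext k
    simpa only [g, N.trans_proj, Function.comp_apply] using (hγf k x hx).symm
  have hg : ContMDiffAt (𝓡 (N.dim a)) (𝓡 (M.dim d)) ∞ g (N.proj a y) := by
    refine (PiLp.contDiff_toLp (𝕜 := ℝ) (n := ∞)).contMDiff.contMDiffAt.comp _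
      (contMDiffAt_pi_space.2 fun k => ContMDiffAt.comp _ ?_ (N.contMDiff_trans _).contMDiffAt)
    rw [N.trans_proj]
    exact (hγ k).contMDiffAt ((N.isOpenMap_proj (b k) _ hV).mem_nhds ⟨y, hy, rfl⟩)
  refine ⟨a, e.symm ∘ g, ContMDiffAt.comp _ ?_ hg, ?_⟩
  · rw [hgf y hy]
    exact contMDiffOn_chart_symm.contMDiffAt (e.open_target.mem_nhds (e.map_source hy))
  · filter_upwards [hV.mem_nhds hy] with x hx
    simp only [Function.comp_apply, hgf x hx, e.left_inv hx]

theorem IsSmoothEmbedding.exists_representsAt {f : N.carrier → M.carrier}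
    (hf : IsSmoothEmbedding f) (hopen : IsOpenMap f) (y : N.carrier) (a₀ d : ℕ) :
    ∃ a ≥ a₀, ∃ φ : N.level a → M.level d, RepresentsAt φ f y ∧
      Function.Surjective (mfderiv (𝓡 (N.dim a)) (𝓡 (M.dim d)) φ (N.proj a y) :
        EuclideanSpace ℝ (Fin (N.dim a)) →L[ℝ] EuclideanSpace ℝ (Fin (M.dim d))) := by
  obtain ⟨a, b, φ, ha, hb, hφ, hφf⟩ := hf
  set i := max a₀ d
  have hdb : d ≤ b i := (le_max_right a₀ d).trans hb.le_apply
  have hφopen : IsOpenMap (φ i) := by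
    refine IsOpenMap.of_comp (N.continuous_proj (a i)) (N.proj_surjective (a i)) ?_
    rw [show φ i ∘ N.proj (a i) = M.proj (b i) ∘ f from funext (hφf i)]
    exact (M.isOpenMap_proj (b i)).comp hopen
  have hφi := (hφ i).isImmersion.contMDiff
  refine ⟨a i, (le_max_left a₀ d).trans ha.le_apply, M.trans hdb ∘ φ i,
    ⟨((M.contMDiff_trans hdb).comp hφi).contMDiffAt, .of_forall fun x => ?_⟩, ?_⟩
  · simp only [Function.comp_apply, hφf, M.trans_proj]
  · have hsection := hasLocalSectionAt_of_isImmersionAt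
      ((hφ i).isImmersion.isImmersionAt (N.proj (a i) y)) (hφopen.nhds_le _)
    rw [mfderiv_comp _ ((M.contMDiff_trans hdb).mdifferentiable (by simp) _)
      (hφi.mdifferentiable (by simp) _)]
    exact (mfderiv_trans_surjective hdb _).comp
      (hsection.mfderiv_surjective (by simp) (hφi.mdifferentiable (by simp) _))

theorem IsDiffeomorphism.exists_semiconj_proj {σ : Equiv.Perm M.carrier} (hσ : IsDiffeomorphism σ)
    (hfin : IsOfFinOrder σ) (d₀ : ℕ) :
    ∃ d ≥ d₀, ∃ ψ : M.level d → M.level d, ContMDiff (𝓡 (M.dim d)) (𝓡 (M.dim d)) ∞ ψ ∧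
      Function.Semiconj (M.proj d) σ ψ := by
  obtain ⟨a, b, φ, ha, hb, hφ⟩ := hσ
  rcases le_total (a d₀) (b d₀) with hab | hba
  · refine ⟨a d₀, ha.le_apply, M.trans hab ∘ φ d₀,
      (M.contMDiff_trans hab).comp (φ d₀).contMDiff, fun x => ?_⟩
    simp only [Function.comp_apply, hφ, M.trans_proj]
  · -- Here only `σ⁻¹` descends to the level `b d₀`, but `σ` is one of its powers.
    have hinv : Function.Semiconj (M.proj (b d₀)) ⇑σ⁻¹ (M.trans hba ∘ (φ d₀).symm) := fun x => by
      have hx := hφ d₀ (σ⁻¹ x)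
      rw [← Equiv.Perm.mul_apply, mul_inv_cancel, Equiv.Perm.one_apply] at hx
      rw [Function.comp_apply, ← hx, Diffeomorph.symm_apply_apply, M.trans_proj]
    obtain ⟨m, hm⟩ : ∃ m : ℕ, σ⁻¹ ^ m = σ :=
      hfin.inv.mem_powers_iff_mem_zpowers.2 (Subgroup.mem_zpowers_iff.2 ⟨-1, by simp⟩)
    refine ⟨b d₀, hb.le_apply, (M.trans hba ∘ (φ d₀).symm)^[m],
      ((M.contMDiff_trans hba).comp (φ d₀).symm.contMDiff).iterate m, ?_⟩
    have := hinv.iterate_right m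
    rwa [Equiv.Perm.iterate_eq_pow, hm] at this

theorem IsDiffeomorphism.eq_one_of_forall_semiconj_eq_id {σ : Equiv.Perm M.carrier}
    (hσ : IsDiffeomorphism σ) (hfin : IsOfFinOrder σ)
    (h : ∀ {d : ℕ} {ψ : M.level d → M.level d}, ContMDiff (𝓡 (M.dim d)) (𝓡 (M.dim d)) ∞ ψ →
      ψ^[orderOf σ] = id → Function.Semiconj (M.proj d) σ ψ → ψ = id) : σ = 1 := by
  ext x
  refine ext_proj fun d₀ => ?_
  obtain ⟨d, hd, ψ, hψ, hψσ⟩ := hσ.exists_semiconj_proj hfin d₀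
  have hψn : ψ^[orderOf σ] = id := by
    refine (M.proj_surjective d).injective_comp_right (funext fun z => ?_)
    have := hψσ.iterate_right (orderOf σ) z
    rw [Equiv.Perm.iterate_eq_pow, pow_orderOf_eq_one] at this
    exact this.symm
  refine ⟨d, hd, ?_⟩
  rw [hψσ x, h hψ hψn hψσ]
  rfl

variable [ConnectedSpace M.carrier] {σ : Equiv.Perm M.carrier}

theorem IsDiffeomorphism.eq_one_of_eventually_eq_self (hσ : IsDiffeomorphism σ)
    (hfin : IsOfFinOrder σ) {x : M.carrier} (hx : ∀ᶠ y in 𝓝 x, σ y = y) : σ = 1 := by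
  refine hσ.eq_one_of_forall_semiconj_eq_id hfin fun {d ψ} hψ hψn hψσ => ?_
  have := connectedSpace_level (M := M) d
  refine eq_id_of_frequently_eventuallyEq_id (hψ.of_le (by simp)) hfin.orderOf_pos.ne' hψn
    (frequently_eventuallyEq_of_comp (x := x) (M.isOpenMap_proj d) (M.continuous_proj d) ?_)
  refine hx.eventually_nhds.frequently.mono fun p hp => hp.mono fun y hy => ?_
  rw [Function.comp_apply, ← hψσ y, hy]
  rfl

theorem IsDiffeomorphism.eq_one_of_frequently_eq_of_frequently_eq_comp (hσ : IsDiffeomorphism σ)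
    (hfin : IsOfFinOrder σ) {φ χ : N.carrier → M.carrier} (hφ : IsSmoothEmbedding φ)
    (hopen : IsOpenMap φ) (hχ : IsSmooth χ) {y : N.carrier} (heq : ∃ᶠ z in 𝓝 y, χ =ᶠ[𝓝 z] φ)
    (heqcomp : ∃ᶠ z in 𝓝 y, χ =ᶠ[𝓝 z] σ ∘ φ) : σ = 1 := by
  refine hσ.eq_one_of_forall_semiconj_eq_id hfin fun {d ψ} hψ hψn hψσ => ?_
  have := connectedSpace_level (M := M) d
  obtain ⟨a₀, χ₀, hχ₀⟩ := hχ.exists_representsAt y d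
  obtain ⟨a, ha, φ', hφ', hsurj⟩ := hφ.exists_representsAt hopen y a₀ d
  have hχ' := hχ₀.comp_trans ha
  have hle : (1 : ℕ∞ω) ≤ ∞ := by simp
  exact eq_id_of_frequently_eq_of_frequently_eq_comp (hψ.of_le hle) hfin.orderOf_pos.ne' hψn
    (hφ'.1.of_le hle) (hχ'.1.of_le hle) hsurj (hχ'.frequently_eventuallyEq hφ' heq)
    (hχ'.frequently_eventuallyEq (hφ'.comp_semiconj hψ hψσ) heqcomp)

end PFMan

namespace SymObj

variable {T : Type w} [Category.{v} T] {F : T ⥤ PFMan.{u}} {G : Type*} [Group G] (M : SymObj F G)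

instance : T2Space M.Pt :=
  inferInstanceAs (T2Space (F.obj M.obj).carrier)

instance : ContinuousConstSMul G M.Pt where
  continuous_const_smul g := (F.map (M.act g).hom).2.1

theorem isDiffeomorphism_toPerm (g : G) :
    PFMan.IsDiffeomorphism (N := F.obj M.obj) (M := F.obj M.obj)
      (MulAction.toPerm g : Equiv.Perm M.Pt) :=
  M.isDiffeomorphism g

theorem isOfFinOrder_toPerm [Finite G] (g : G) :
    IsOfFinOrder (MulAction.toPerm g : Equiv.Perm M.Pt) :=
  (MulAction.toPermHom G M.Pt).isOfFinOrder (isOfFinOrder_of_finite g)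

variable {M}

theorem eq_of_toPerm_inv_mul_eq_one [FaithfulSMul G M.Pt] {g k : G}
    (h : (MulAction.toPerm (g⁻¹ * k) : Equiv.Perm M.Pt) = 1) : g = k :=
  eq_of_inv_mul_eq_one (MulAction.toPerm_injective (β := M.Pt)
    (h.trans (map_one (MulAction.toPermHom G M.Pt)).symm))

theorem eq_of_eventually_smul_eq [Finite G] [ConnectedSpace M.Pt] [FaithfulSMul G M.Pt] {g k : G}
    {x : M.Pt} (h : ∀ᶠ y in 𝓝 x, g • y = k • y) : g = k := by
  have : ConnectedSpace (F.obj M.obj).carrier := inferInstanceAs (ConnectedSpace M.Pt)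
  refine eq_of_toPerm_inv_mul_eq_one (M := M) <|
    (M.isDiffeomorphism_toPerm _).eq_one_of_eventually_eq_self (M.isOfFinOrder_toPerm _) (x := x) ?_
  refine h.mono fun y (hy : g • y = k • y) => ?_
  change (g⁻¹ * k) • y = y
  rw [mul_smul, ← hy, inv_smul_smul]

theorem mk_eq_mk_iff_exists_smul_eq {x y : M.Pt} :
    (Quotient.mk'' x : M.OrbitSpace) = Quotient.mk'' y ↔ ∃ g : G, g • y = x :=
  Quotient.eq''

end SymObj

namespace SymHom

variable {T : Type w} [Category.{v} T] {F : T ⥤ PFMan.{u}} {H G : Type*} [Group H] [Group G]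
  {N : SymObj F H} {M : SymObj F G} {Φ Φ' : SymHom N M}

theorem continuous_toFun (Φ : SymHom N M) : Continuous Φ.toFun :=
  (F.map Φ.mor).2.1

theorem toFun_smul (Φ : SymHom N M) (h : H) (y : N.Pt) : Φ.toFun (h • y) = Φ.ι h • Φ.toFun y :=
  Φ.equivariant h y

theorem orbitMap_mk (Φ : SymHom N M) (y : N.Pt) :
    Φ.orbitMap (Quotient.mk'' y) = Quotient.mk'' (Φ.toFun y) :=
  rfl

theorem mor_eq_comp_act_iff [F.Faithful] {g : G} :
    Φ'.mor = Φ.mor ≫ (M.act g).hom ↔ ∀ y, Φ'.toFun y = g • Φ.toFun y := by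
  rw [← F.map_injective.eq_iff, F.map_comp, Subtype.ext_iff, funext_iff]
  rfl

theorem orbitMap_eq_of_equivalent (h : Φ.Equivalent Φ') : Φ.orbitMap = Φ'.orbitMap := by
  obtain ⟨g, hg, -⟩ := h
  ext1 y
  induction y using Quotient.inductionOn' with | h y => ?_
  rw [orbitMap_mk, orbitMap_mk, eq_comm, SymObj.mk_eq_mk_iff_exists_smul_eq]
  refine ⟨g, ?_⟩
  change _ = (F.map Φ'.mor).1 y
  rw [hg, F.map_comp]
  rfl

theorem smul_range_eq_of_mem_range (Φ : SymHom N M) {g : G} (hg : g ∈ Φ.ι.range) :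
    (fun x => g • x) '' Set.range Φ.toFun = Set.range Φ.toFun := by
  obtain ⟨h, rfl⟩ := hg
  have hcomp : (fun x => Φ.ι h • x) ∘ Φ.toFun = Φ.toFun ∘ fun y => h • y :=
    funext fun y => (Φ.toFun_smul h y).symm
  rw [← Set.range_comp, hcomp, (MulAction.surjective h).range_comp]

theorem smul_toFun_mem_range_iff (hinj : Function.Injective Φ.orbitMap) {g : G} {y : N.Pt} :
    g • Φ.toFun y ∈ Set.range Φ.toFun ↔ ∃ γ : Φ.ι.range, g • Φ.toFun y = (γ : G) • Φ.toFun y := by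
  constructor
  · rintro ⟨z, hz⟩
    have hzy : (Quotient.mk'' z : N.OrbitSpace) = Quotient.mk'' y := by
      refine hinj ?_
      rw [orbitMap_mk, orbitMap_mk, SymObj.mk_eq_mk_iff_exists_smul_eq]
      exact ⟨g, hz.symm⟩
    obtain ⟨h, rfl⟩ := SymObj.mk_eq_mk_iff_exists_smul_eq.1 hzy
    exact ⟨⟨Φ.ι h, h, rfl⟩, hz.symm.trans (Φ.toFun_smul h y)⟩
  · rintro ⟨⟨_, h, rfl⟩, hy⟩
    exact ⟨h • y, (Φ.toFun_smul h y).trans hy.symm⟩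

variable [Finite G] [ConnectedSpace M.Pt] [FaithfulSMul G M.Pt]

theorem eq_of_eventually_smul_toFun_eq (hopen : IsOpenMap Φ.toFun) {g k : G} {y : N.Pt}
    (h : ∀ᶠ z in 𝓝 y, g • Φ.toFun z = k • Φ.toFun z) : g = k :=
  SymObj.eq_of_eventually_smul_eq (hopen.nhds_le y (Filter.eventually_map.2 h))

theorem eq_of_frequently_toFun_eventuallyEq_smul (hΦ : PFMan.IsSmoothEmbedding (F.map Φ.mor).1)
    (hopen : IsOpenMap Φ.toFun) {g k : G} {y : N.Pt}
    (hg : ∃ᶠ z in 𝓝 y, ∀ᶠ w in 𝓝 z, Φ'.toFun w = g • Φ.toFun w)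
    (hk : ∃ᶠ z in 𝓝 y, ∀ᶠ w in 𝓝 z, Φ'.toFun w = k • Φ.toFun w) : g = k := by
  have : ConnectedSpace (F.obj M.obj).carrier := inferInstanceAs (ConnectedSpace M.Pt)
  refine SymObj.eq_of_toPerm_inv_mul_eq_one (M := M) <|
    (M.isDiffeomorphism_toPerm _).eq_one_of_frequently_eq_of_frequently_eq_comp
      (M.isOfFinOrder_toPerm _) hΦ hopen (F.map Φ'.mor ≫ F.map (M.act g⁻¹).hom).2 (y := y)
      (hg.mono fun z hz => hz.mono fun w (hw : Φ'.toFun w = g • Φ.toFun w) => ?_)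
      (hk.mono fun z hz => hz.mono fun w (hw : Φ'.toFun w = k • Φ.toFun w) => ?_)
  · change g⁻¹ • Φ'.toFun w = Φ.toFun w
    rw [hw, inv_smul_smul]
  · change g⁻¹ • Φ'.toFun w = (g⁻¹ * k) • Φ.toFun w
    rw [hw, mul_smul]

variable [ConnectedSpace N.Pt]

theorem exists_toFun_eq_smul_of_orbitMap_eq (hΦ : PFMan.IsSmoothEmbedding (F.map Φ.mor).1)
    (hopen : IsOpenMap Φ.toFun) (h : Φ.orbitMap = Φ'.orbitMap) :
    ∃ g : G, ∀ y, Φ'.toFun y = g • Φ.toFun y := by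
  let C (g : G) : Set N.Pt := {y | Φ'.toFun y = g • Φ.toFun y}
  have hclosed (g : G) : IsClosed (C g) :=
    isClosed_eq Φ'.continuous_toFun (Φ.continuous_toFun.const_smul g)
  have hcover : ⋃ g, C g = Set.univ := by
    refine Set.iUnion_eq_univ_iff.2 fun y => ?_
    obtain ⟨g, hg⟩ := SymObj.mk_eq_mk_iff_exists_smul_eq.1 (congrFun h (Quotient.mk'' y)).symm
    exact ⟨g, hg.symm⟩
  have hdisj : Pairwise (Function.onFun Disjoint fun g => closure (interior (C g))) := by
    refine fun g k hgk => Set.disjoint_left.2 fun y hg hk => hgk ?_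
    exact eq_of_frequently_toFun_eventuallyEq_smul hΦ hopen
      (mem_closure_interior_setOf_iff.1 hg) (mem_closure_interior_setOf_iff.1 hk)
  obtain ⟨g, hg⟩ := exists_eq_univ_of_disjoint_closure_interior hclosed hcover hdisj
  exact ⟨g, Set.eq_univ_iff_forall.1 hg⟩

theorem equivalent_iff_orbitMap_eq [F.Faithful] (hΦ : PFMan.IsSmoothEmbedding (F.map Φ.mor).1)
    (hopen : IsOpenMap Φ.toFun) : Φ.Equivalent Φ' ↔ Φ.orbitMap = Φ'.orbitMap := by
  refine ⟨orbitMap_eq_of_equivalent, fun h => ?_⟩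
  obtain ⟨g, hg⟩ := exists_toFun_eq_smul_of_orbitMap_eq hΦ hopen h
  obtain ⟨y⟩ := (inferInstance : Nonempty N.Pt)
  refine ⟨g, mor_eq_comp_act_iff.2 hg, fun h => ?_⟩
  have hconj : g⁻¹ * Φ'.ι h * g = Φ.ι h := by
    refine eq_of_eventually_smul_toFun_eq hopen (y := y) (.of_forall fun z => ?_)
    rw [mul_smul, mul_smul, ← hg, ← Φ'.toFun_smul, hg, inv_smul_smul, Φ.toFun_smul]
  rw [← hconj]
  group

theorem mem_range_of_smul_range_inter_nonempty (hinj : Function.Injective Φ.orbitMap)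
    (hopen : IsOpenMap Φ.toFun) {g : G}
    (hg : (((fun x => g • x) '' Set.range Φ.toFun) ∩ Set.range Φ.toFun).Nonempty) :
    g ∈ Φ.ι.range := by
  let C (γ : Φ.ι.range) : Set N.Pt := {y | g • Φ.toFun y = (γ : G) • Φ.toFun y}
  have hclosed (γ) : IsClosed (C γ) :=
    isClosed_eq (Φ.continuous_toFun.const_smul g) (Φ.continuous_toFun.const_smul (γ : G))
  have hunion : ⋃ γ, C γ = (fun y => g • Φ.toFun y) ⁻¹' Set.range Φ.toFun := by
    ext y
    exact Set.mem_iUnion.trans (smul_toFun_mem_range_iff hinj).symm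
  have hclopen : IsClopen (⋃ γ, C γ) := by
    refine ⟨isClosed_iUnion_of_finite hclosed, ?_⟩
    rw [hunion]
    exact hopen.isOpen_range.preimage (Φ.continuous_toFun.const_smul g)
  have hcover : ⋃ γ, C γ = Set.univ := by
    obtain ⟨_, ⟨_, ⟨y, rfl⟩, rfl⟩, hy⟩ := hg
    exact hclopen.eq_univ ⟨y, hunion ▸ hy⟩
  obtain ⟨z, hz⟩ := (dense_iUnion_interior_of_finite_closed hclosed hcover).nonempty
  obtain ⟨γ, hγ⟩ := Set.mem_iUnion.1 hz
  rw [eq_of_eventually_smul_toFun_eq hopen (mem_interior_iff_mem_nhds.1 hγ)]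
  exact γ.2

end SymHom

theorem mainTheorem8_general {T : Type w} [Category.{v} T] (F : T ⥤ PFMan.{u}) [F.Faithful]
    {G H : Type*} [Group G] [Finite G] [Group H] (N : SymObj F H) (M : SymObj F G)
    [ConnectedSpace N.Pt] [ConnectedSpace M.Pt] [FaithfulSMul G M.Pt] :
    (∀ Φ Φ' : SymHom N M, PFMan.IsSmoothEmbedding (F.map Φ.mor).1 → IsOpenMap Φ.toFun →
      (Φ.Equivalent Φ' ↔ Φ.orbitMap = Φ'.orbitMap)) ∧
    (∀ Φ : SymHom N M, Function.Injective Φ.orbitMap → IsOpenMap Φ.toFun → ∀ g : G,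
      (((fun x => g • x) '' Set.range Φ.toFun) ∩ Set.range Φ.toFun).Nonempty →
      (fun x => g • x) '' Set.range Φ.toFun = Set.range Φ.toFun ∧ g ∈ Φ.ι.range) := by
  refine ⟨fun Φ Φ' hΦ hopen => SymHom.equivalent_iff_orbitMap_eq hΦ hopen,
    fun Φ hinj hopen g hg => ?_⟩
  have hmem := SymHom.mem_range_of_smul_range_inter_nonempty hinj hopen hg
  exact ⟨Φ.smul_range_eq_of_mem_range hmem, hmem⟩

theorem mainTheorem8 {T : Type w} [Category.{v} T] (F : T ⥤ PFMan.{u}) [F.Faithful]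
    {G H : Type*} [Group G] [Finite G] [Group H] [Finite H]
    (N : SymObj F H) (M : SymObj F G) [ConnectedSpace N.Pt] [ConnectedSpace M.Pt]
    [FaithfulSMul G M.Pt] :
    (FaithfulSMul H N.Pt → ∀ Φ Φ' : SymHom N M, Φ.IsOpenEmbedding → Φ'.IsOpenEmbedding →
      (Φ.Equivalent Φ' ↔ Φ.orbitMap = Φ'.orbitMap)) ∧
    (∀ Φ : SymHom N M, Φ.IsOpenEmbedding → ∀ g : G,
      (((fun x => g • x) '' Set.range Φ.toFun) ∩ Set.range Φ.toFun).Nonempty →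
      (fun x => g • x) '' Set.range Φ.toFun = Set.range Φ.toFun ∧ g ∈ Φ.ι.range) :=
  (mainTheorem8_general F N M).imp (fun h _ Φ Φ' hΦ _ => h Φ Φ' hΦ.1.1 hΦ.2)
    fun h Φ hΦ => h Φ hΦ.1.2.injective hΦ.2
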